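/- \textbf{Conventions.} A visibly pushdown alphabet is a finite alphabet $\Sigma=\Sigma_{call}\sqcup\Sigma_{int}\sqcup\Sigma_{ret}$. The set $\Sigma^\triangle$ of well-matched words is the smallest set that contains $\varepsilon$ and all $c\in\Sigma_{int}$, is closed under concatenation, and contains $awb$ whenever it contains $w$, $a\in\Sigma_{call}$, $b\in\Sigma_{ret}$. A context is a pair $(u,v)$ of words with $uv\in\Sigma^\triangle$; it induces the map $\mathrm{ext}_{u,v}\colon\Sigma^\triangle\to\Sigma^\triangle$, $x\mapsto uxv$. Let $\Delta(w)$ be the number of call letters minus the number of return letters of $w$. A visibly pushdown language (VPL) is a language accepted by a deterministic visibly pushdown automaton, where acceptance is in a final state with only the bottom symbol on the stack; so $L\subseteq\Sigma^\triangle$. For a VPL $L$ let $x\sim_L y$ ($x,y\in\Sigma^\triangle$) if $uxv\in L\Leftrightarrow uyv\in L$ for all contexts $(u,v)$. Let $R_L=\Sigma^\triangle/{\sim_L}$, let $\varphi_L\colon\Sigma^\triangle\to R_L$ be the quotient map, let $\psi_L(\mathrm{ext}_{u,v})\colon R_L\to R_L$ be the map induced by $\mathrm{ext}_{u,v}$,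 and let $O_L$ be the monoid of all these maps (the syntactic Ext-algebra $(R_L,O_L)$ and syntactic morphism $(\varphi_L,\psi_L)$ of $L$). An element $e\in O_L$ is $\varphi_L(L)$-reachable if $f(e(r))\in\varphi_L(L)$ for some $r\in R_L$, $f\in O_L$. The VPL $L$ is \emph{weakly length-synchronous} if for every $\varphi_L(L)$-reachable idempotent $e\in O_L$ and all contexts $(u,v),(u',v')$ with $\psi_L(\mathrm{ext}_{u,v})=\psi_L(\mathrm{ext}_{u',v'})=e$ and $\Delta(u),\Delta(u')>0$: $u=u'$ implies $|v|=|v'|$, and $v=v'$ implies $|u|=|u'|$. Languages over an arbitrary finite alphabet are identified with binary languages through an arbitrary fixed injective encoding of the letters by blocks of bits of one fixed positive length. For binary languages $K,B$ we write $K\leq_{\mathrm{cd}}B$ (constant-depth truth-table reducibility) if $K$ is decided by a (non-uniform) family of circuits $(C_n)_n$ of constant depth and of size polynomial in $n$ whose gates are NOT gates, unbounded fan-in AND and OR gates, and oracle gates for $B$ (of arbitrary fan-in; size counts gates and wires), such that no path leads from an oracle gate to another oracle gate. We write $K\leq_{\mathrm{cd}}^{T}B$ (constant-depth reducibility) if the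 same holds without the last condition, so that oracle gates may be nested. $\mathsf{TC}^0$ is the class of languages decided by (non-uniform) circuit families of constant depth and polynomial size with NOT gates and unbounded fan-in AND, OR and majority gates. Let $\mathrm{EQUALITY}=\{w\in\{0,1\}^*:|w|_0=|w|_1\}$. \textbf{Proposition.} Let $L$ be a VPL that is not weakly length-synchronous. Then \begin{enumerate} \item $\mathrm{EQUALITY}\leq_{\mathrm{cd}}L$; \item every language $K$ with $K\leq_{\mathrm{cd}}\mathrm{EQUALITY}$ satisfies $K\leq_{\mathrm{cd}}L$; \item $L$ is $\mathsf{TC}^0$-hard under constant-depth reductions: $K\leq_{\mathrm{cd}}^{T}L$ for every $K\in\mathsf{TC}^0$. \end{enumerate} -/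

import Mathlib

universe u

namespace VPL

/-! ### Visibly pushdown alphabets, well-matched words, contexts -/

/-- The three kinds of letters. A visibly pushdown alphabet is a finite type `A` together with a
map `κ : A → LetterKind`; the fibres of `κ` are the call, internal and return letters. -/
inductive LetterKind where
  | call
  | int
  | ret
deriving DecidableEq

section Alphabet

variable {A : Type u} (κ : A → LetterKind)

/-- Well-matched words. -/
inductive WellMatched : List A → Prop where
  | nil : WellMatched []
  | internal (c : A) (hc : κ c = LetterKind.int) : WellMatched [c]
  | wrap (a b : A) (w : List A) (ha : κ a = LetterKind.call) (hb : κ b = LetterKind.ret)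
      (hw : WellMatched w) : WellMatched (a :: (w ++ [b]))
  | append (s t : List A) (hs : WellMatched s) (ht : WellMatched t) : WellMatched (s ++ t)

/-- The height `Δ(w)`: number of call letters minus number of return letters. -/
def height (w : List A) : ℤ :=
  ((w.countP fun a => decide (κ a = LetterKind.call) : ℕ) : ℤ) -
    ((w.countP fun a => decide (κ a = LetterKind.ret) : ℕ) : ℤ)

/-- The set of contexts: pairs `(u, v)` of words such that `uv` is well-matched. -/
def contexts : Set (List A × List A) := {σ | WellMatched κ (σ.1 ++ σ.2)}

variable {κ}

theorem WellMatched.insert {x : List A} (hx : WellMatched κ x) :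
    ∀ u v w : List A, x = u ++ v → WellMatched κ w → WellMatched κ (u ++ w ++ v) := by
  induction hx with
  | nil =>
    intro u v w h hw
    obtain ⟨rfl, rfl⟩ := List.append_eq_nil_iff.1 h.symm
    simpa using hw
  | internal c hc =>
    intro u v w h hw
    rcases List.append_eq_singleton_iff.1 h.symm with ⟨rfl, rfl⟩ | ⟨rfl, rfl⟩
    · simpa using hw.append _ _ (.internal c hc)
    · simpa using (WellMatched.internal c hc).append _ _ hw
  | wrap a b y ha hb hy ih =>
    intro u v w h hw
    cases u with
    | nil =>
      simp only [List.nil_append] at h ⊢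
      subst h
      exact hw.append _ _ (.wrap a b y ha hb hy)
    | cons a' u' =>
      simp only [List.cons_append, List.cons.injEq] at h
      obtain ⟨rfl, h⟩ := h
      rcases List.eq_nil_or_concat v with rfl | ⟨v', b', rfl⟩
      · simp only [List.append_nil] at h ⊢
        subst h
        simpa using (WellMatched.wrap a b y ha hb hy).append _ _ hw
      · rw [List.concat_eq_append, ← List.append_assoc] at h
        obtain ⟨h1, h2⟩ := List.append_inj' h rfl
        simp only [List.cons.injEq, and_true] at h2
        subst h2
        have := WellMatched.wrap a b _ ha hb (ih u' v' w h1 hw)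
        simpa using this
  | append s t hs ht ihs iht =>
    intro u v w h hw
    rcases List.append_eq_append_iff.1 h with ⟨r, rfl, rfl⟩ | ⟨r, rfl, rfl⟩
    · have := hs.append _ _ (iht r v w rfl hw)
      simpa using this
    · have := (ihs u r w rfl hw).append _ _ ht
      simpa using this

variable (κ)

/-- The monoid of well-matched words. -/
def words : Submonoid (FreeMonoid A) where
  carrier := {w | WellMatched κ (FreeMonoid.toList w)}
  one_mem' := WellMatched.nil
  mul_mem' := fun hs ht => WellMatched.append _ _ hs ht

variable {κ}

/-- The underlying list of letters of a well-matched word. -/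
def wordList (w : words κ) : List A := FreeMonoid.toList w.1

/-- The map `ext_{u,v} : x ↦ u x v` on well-matched words, for a context `(u, v)`. -/
def ext (σ : List A × List A) (hσ : σ ∈ contexts κ) : Function.End (words κ) :=
  fun x => ⟨FreeMonoid.ofList (σ.1 ++ wordList x ++ σ.2),
    WellMatched.insert hσ σ.1 σ.2 (wordList x) rfl x.2⟩

theorem contexts_comp {σ τ : List A × List A} (hσ : σ ∈ contexts κ) (hτ : τ ∈ contexts κ) :
    (σ.1 ++ τ.1, τ.2 ++ σ.2) ∈ contexts κ := by
  have := WellMatched.insert hσ σ.1 σ.2 _ rfl hτ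
  simpa [contexts] using this

theorem contexts_one : (([], []) : List A × List A) ∈ contexts κ := WellMatched.nil

/-- Weak length-synchronicity of a set of contexts. -/
def WeaklyLengthSynchronousSet (κ : A → LetterKind) (S : Set (List A × List A)) : Prop :=
  ∀ σ ∈ S, ∀ τ ∈ S, 0 < height κ σ.1 → 0 < height κ τ.1 →
    (σ.1 = τ.1 → σ.2.length = τ.2.length) ∧ (σ.2 = τ.2 → σ.1.length = τ.1.length)

end Alphabet

/-! ### Ext-algebras -/

/-- An Ext-algebra: a monoid `R` and a submonoid `O` of the monoid of all maps `R → R` under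
composition that contains all left and right multiplications. -/
structure ExtAlgebra where
  R : Type u
  [monoid : Monoid R]
  O : Submonoid (Function.End R)
  left_mem : ∀ r : R, (fun x => r * x : Function.End R) ∈ O
  right_mem : ∀ r : R, (fun x => x * r : Function.End R) ∈ O

attribute [instance] ExtAlgebra.monoid

namespace ExtAlgebra

/-- Morphisms of Ext-algebras. -/
structure Hom (X Y : ExtAlgebra.{u}) where
  φ : X.R →* Y.R
  ψ : X.O →* Y.O
  apply_apply : ∀ (e : X.O) (r : X.R), (ψ e).1 (φ r) = φ (e.1 r)
  map_left : ∀ r : X.R, ψ ⟨_, X.left_mem r⟩ = ⟨_, Y.left_mem (φ r)⟩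
  map_right : ∀ r : X.R, ψ ⟨_, X.right_mem r⟩ = ⟨_, Y.right_mem (φ r)⟩

/-- A congruence: an equivalence relation preserved by all elements of `O`. -/
structure Congruence (X : ExtAlgebra.{u}) where
  rel : Setoid X.R
  map_rel : ∀ e ∈ X.O, ∀ x y : X.R, rel x y → rel (e x) (e y)

/-- A congruence of an Ext-algebra is in particular a congruence of the monoid `R`. -/
def Congruence.toCon {X : ExtAlgebra.{u}} (c : X.Congruence) : Con X.R where
  toSetoid := c.rel
  mul' := fun {w x y z} h₁ h₂ =>
    c.rel.trans (c.map_rel _ (X.right_mem y) w x h₁) (c.map_rel _ (X.left_mem x) y z h₂)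

/-- The quotient of an Ext-algebra by a congruence. -/
def quotient (X : ExtAlgebra.{u}) (c : X.Congruence) : ExtAlgebra.{u} where
  R := c.toCon.Quotient
  O :=
    { carrier := {e' | ∃ e ∈ X.O, ∀ x : X.R, e' (x : c.toCon.Quotient) = (e x : X.R)}
      one_mem' := ⟨1, X.O.one_mem, fun _ => rfl⟩
      mul_mem' := by
        rintro e' f' ⟨e, he, hee⟩ ⟨f, hf, hff⟩
        refine ⟨e * f, X.O.mul_mem he hf, fun x => ?_⟩
        change e' (f' _) = ((e (f x) : X.R) : c.toCon.Quotient)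
        rw [hff, hee] }
  left_mem := by
    intro r
    induction r using Con.induction_on with
    | H r => exact ⟨_, X.left_mem r, fun _ => rfl⟩
  right_mem := by
    intro r
    induction r using Con.induction_on with
    | H r => exact ⟨_, X.right_mem r, fun _ => rfl⟩

/-- The map induced on the quotient by an element of `O`. -/
def quotientMap (X : ExtAlgebra.{u}) (c : X.Congruence) (e : X.O) : Function.End c.toCon.Quotient :=
  Quotient.map' e.1 (fun x y h => c.map_rel e.1 e.2 x y h)

/-- The morphism associated to a congruence. -/
def quotientHom (X : ExtAlgebra.{u}) (c : X.Congruence) : Hom X (X.quotient c) where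
  φ := c.toCon.mk'
  ψ :=
    { toFun := fun e => ⟨X.quotientMap c e, e.1, e.2, fun _ => rfl⟩
      map_one' := by
        apply Subtype.ext
        funext x
        induction x using Con.induction_on with
        | H x => rfl
      map_mul' := by
        intro e f
        apply Subtype.ext
        funext x
        induction x using Con.induction_on with
        | H x => rfl }
  apply_apply := fun _ _ => rfl
  map_left := by
    intro r
    apply Subtype.ext
    funext x
    induction x using Con.induction_on with
    | H x => rfl
  map_right := by
    intro r
    apply Subtype.ext
    funext x
    induction x using Con.induction_on with
    | H x => rfl

/-- `r` is `F`-reachable if `e(r) ∈ F` for some `e ∈ O`. -/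
def Reachable (X : ExtAlgebra.{u}) (F : Set X.R) (r : X.R) : Prop := ∃ e ∈ X.O, e r ∈ F

/-- `e` is `F`-reachable if `e(r)` is `F`-reachable for some `r`. -/
def OpReachable (X : ExtAlgebra.{u}) (F : Set X.R) (e : X.O) : Prop :=
  ∃ r : X.R, X.Reachable F (e.1 r)

end ExtAlgebra

section Free

variable {A : Type u} (κ : A → LetterKind)

/-- The Ext-algebra of well-matched words, with the maps `ext_{u,v}`. -/
def freeExt : ExtAlgebra.{u} where
  R := words κ
  O :=
    { carrier := {e | ∃ (σ : List A × List A) (hσ : σ ∈ contexts κ), e = ext σ hσ}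
      one_mem' := by
        refine ⟨([], []), contexts_one, ?_⟩
        funext x
        apply Subtype.ext
        simp [ext, wordList]
        rfl
      mul_mem' := by
        rintro _ _ ⟨σ, hσ, rfl⟩ ⟨τ, hτ, rfl⟩
        refine ⟨_, contexts_comp hσ hτ, ?_⟩
        funext x
        apply Subtype.ext
        apply FreeMonoid.toList.injective
        change _ ++ FreeMonoid.toList (FreeMonoid.ofList _) ++ _ = FreeMonoid.toList (FreeMonoid.ofList _)
        simp }
  left_mem := by
    intro r
    refine ⟨(wordList r, []), ?_, ?_⟩
    · have h : WellMatched κ (wordList r) := r.2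
      simpa [contexts] using h
    funext x
    apply Subtype.ext
    apply FreeMonoid.toList.injective
    change _ ++ _ = FreeMonoid.toList (FreeMonoid.ofList _)
    simp [wordList]
  right_mem := by
    intro r
    refine ⟨([], wordList r), ?_, ?_⟩
    · have h : WellMatched κ (wordList r) := r.2
      simpa [contexts] using h
    funext x
    apply Subtype.ext
    apply FreeMonoid.toList.injective
    change _ ++ _ = FreeMonoid.toList (FreeMonoid.ofList _)
    simp [wordList]

variable {κ}

/-- `ext_{u,v}` as an element of the Ext-algebra of well-matched words. -/
def extOp (σ : List A × List A) (hσ : σ ∈ contexts κ) : (freeExt κ).O := ⟨ext σ hσ, σ, hσ, rfl⟩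

/-- The set of contexts `𝓡_e = {(u, v) | ψ(ext_{u,v}) = e}`. -/
def contextsOver {X : ExtAlgebra.{u}} (h : ExtAlgebra.Hom (freeExt κ) X) (e : X.O) :
    Set (List A × List A) :=
  {σ | ∃ hσ : σ ∈ contexts κ, h.ψ (extOp σ hσ) = e}

/-- `F`-weak length-synchronicity of a morphism from the Ext-algebra of well-matched words. -/
def ExtAlgebra.Hom.WeaklyLengthSynchronous {X : ExtAlgebra.{u}}
    (h : ExtAlgebra.Hom (freeExt κ) X) (F : Set X.R) : Prop :=
  ∀ e : X.O, IsIdempotentElem e → X.OpReachable F e →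
    WeaklyLengthSynchronousSet κ (contextsOver h e)

variable (κ)

/-- The well-matched words that belong to `L`. -/
def wordsIn (L : Set (List A)) : Set (freeExt κ).R := {w : words κ | wordList w ∈ L}

/-- The syntactic congruence of a language of well-matched words. -/
def syntacticCongruence (L : Set (List A)) : (freeExt κ).Congruence where
  rel :=
    { r := fun x y => ∀ e ∈ (freeExt κ).O, e x ∈ wordsIn κ L ↔ e y ∈ wordsIn κ L
      iseqv :=
        { refl := fun _ _ _ => Iff.rfl
          symm := fun h e he => (h e he).symm
          trans := fun h₁ h₂ e he => (h₁ e he).trans (h₂ e he) } }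
  map_rel := fun f hf _ _ h e he => h (e * f) ((freeExt κ).O.mul_mem he hf)

/-- The syntactic Ext-algebra. -/
def syntacticExt (L : Set (List A)) : ExtAlgebra.{u} :=
  (freeExt κ).quotient (syntacticCongruence κ L)

/-- The syntactic morphism. -/
def syntacticHom (L : Set (List A)) : ExtAlgebra.Hom (freeExt κ) (syntacticExt κ L) :=
  (freeExt κ).quotientHom (syntacticCongruence κ L)

/-- Weak length-synchronicity of a language `L` of well-matched words: its syntactic morphism
`(φ, ψ)` is `φ(L)`-weakly length-synchronous. -/
def WeaklyLengthSynchronous (L : Set (List A)) : Prop :=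
  (syntacticHom κ L).WeaklyLengthSynchronous ((syntacticHom κ L).φ '' wordsIn κ L)

/-! ### Visibly pushdown languages -/

/-- Deterministic visibly pushdown automata with states `Q` and stack alphabet `G`. The first
letter of a stack content is the top of the stack. -/
structure DVPA (Q G : Type) where
  δ : Q → A → G → Q × List G
  start : Q
  final : Set Q
  bot : G
  δ_call : ∀ q a α, κ a = LetterKind.call → ∃ γ, γ ≠ bot ∧ (δ q a α).2 = [γ, α]
  δ_ret : ∀ q a α, κ a = LetterKind.ret → (δ q a α).2 = []
  δ_int : ∀ q a α, κ a = LetterKind.int → (δ q a α).2 = [α]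

variable {κ}

/-- The extended transition function. -/
def DVPA.run {Q G : Type} (M : DVPA κ Q G) : Q → List A → List G → Q × List G
  | q, [], β => (q, β)
  | q, _ :: _, [] => (q, [])
  | q, a :: w, α :: β => M.run (M.δ q a α).1 w ((M.δ q a α).2 ++ β)

/-- The accepted language. -/
def DVPA.language {Q G : Type} (M : DVPA κ Q G) : Set (List A) :=
  {w | (M.run M.start w [M.bot]).1 ∈ M.final ∧ (M.run M.start w [M.bot]).2 = [M.bot]}

variable (κ)

/-- Visibly pushdown languages. -/
def IsVPL (L : Set (List A)) : Prop :=
  ∃ (Q G : Type) (_ : Finite Q) (_ : Finite G) (M : DVPA κ Q G), L = M.language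

end Free

/-! ### Circuits -/

/-- Gates with inputs from `α`: AND, OR, majority and oracle gates of arbitrary fan-in, and NOT
gates. Oracle gates read their inputs as a binary word. -/
inductive Gate (α : Type) where
  | and (l : List α)
  | or (l : List α)
  | not (a : α)
  | maj (l : List α)
  | oracle (l : List α)

namespace Gate

variable {α : Type}

/-- The list of inputs of a gate. -/
def inputs : Gate α → List α
  | and l => l
  | or l => l
  | not a => [a]
  | maj l => l
  | oracle l => l

/-- Majority gates. -/
def IsMaj : Gate α → Prop
  | maj _ => True
  | _ => False

/-- Oracle gates. -/
def IsOracle : Gate α → Prop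
  | oracle _ => True
  | _ => False

open Classical in
/-- The value of a gate, given the values `f` of its inputs, for the oracle language `B`. -/
noncomputable def eval (B : Set (List Bool)) (f : α → Bool) : Gate α → Bool
  | and l => l.all f
  | or l => l.any f
  | not a => !(f a)
  | maj l => decide (l.length < 2 * l.countP f)
  | oracle l => decide (l.map f ∈ B)

end Gate

/-- A Boolean circuit with `n` inputs. The gates form a finite type `V`; every wire into a gate
comes from one of the `n` input nodes or from another gate. The function `level` makes the
circuit acyclic: a wire between gates goes to a strictly higher level. -/
structure Circuit (n : ℕ) where
  V : Type
  [fintype : Fintype V]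
  gate : V → Gate (Fin n ⊕ V)
  level : V → ℕ
  level_lt : ∀ u v : V, Sum.inr u ∈ (gate v).inputs → level u < level v
  out : Fin n ⊕ V

attribute [instance] Circuit.fintype

namespace Circuit

variable {n : ℕ} (C : Circuit n)

/-- Size: the number of gates plus the number of wires. -/
def size : ℕ := ∑ v : C.V, (1 + (C.gate v).inputs.length)

/-- Depth at most `d`: all gates lie in the levels `0, …, d - 1`. (A circuit has no path through
more than `d` gates exactly if its gates can be arranged in `d` levels.) -/
def DepthLE (d : ℕ) : Prop := ∀ v : C.V, C.level v < d

/-- There is a wire from gate `u` to gate `v`. -/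
def Wire (u v : C.V) : Prop := Sum.inr u ∈ (C.gate v).inputs

/-- No path leads from an oracle gate to another oracle gate. -/
def OraclesNotNested : Prop :=
  ∀ u v : C.V, (C.gate u).IsOracle → (C.gate v).IsOracle → ¬ Relation.TransGen C.Wire u v

/-- No majority gates. -/
def NoMaj : Prop := ∀ v : C.V, ¬ (C.gate v).IsMaj

/-- No oracle gates. -/
def NoOracle : Prop := ∀ v : C.V, ¬ (C.gate v).IsOracle

/-- Auxiliary: evaluation of gates by recursion on the level. -/
noncomputable def valAux (B : Set (List Bool)) (x : Fin n → Bool) : ℕ → C.V → Bool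
  | 0, _ => false
  | k + 1, v => (C.gate v).eval B (Sum.elim x (valAux B x k))

/-- The value of a gate on input `x`, with oracle language `B`. -/
noncomputable def val (B : Set (List Bool)) (x : Fin n → Bool) (v : C.V) : Bool :=
  C.valAux B x (C.level v + 1) v

/-- The value computed by the circuit at its output node. -/
noncomputable def eval (B : Set (List Bool)) (x : Fin n → Bool) : Bool :=
  Sum.elim x (C.val B x) C.out

theorem _root_.VPL.Gate.eval_congr {α : Type} (B : Set (List Bool)) (g : Gate α) {f f' : α → Bool}
    (h : ∀ a ∈ g.inputs, f a = f' a) : g.eval B f = g.eval B f' := by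
  cases g with
  | and l => simp only [Gate.eval, Gate.inputs] at *; exact Bool.eq_iff_iff.2 (by simp +contextual [List.all_eq_true, h])
  | or l => simp only [Gate.eval, Gate.inputs] at *; exact Bool.eq_iff_iff.2 (by simp only [List.any_eq_true]; exact exists_congr fun a => and_congr_right fun ha => by rw [h a ha])
  | not a => simp only [Gate.eval, Gate.inputs, List.mem_singleton, forall_eq] at *; rw [h]
  | maj l =>
    simp only [Gate.eval, Gate.inputs] at *
    rw [List.countP_congr (fun a ha => by rw [h a ha])]
  | oracle l =>
    simp only [Gate.eval, Gate.inputs] at *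
    rw [List.map_congr_left h]

theorem valAux_eq (B : Set (List Bool)) (x : Fin n → Bool) :
    ∀ (k l : ℕ) (v : C.V), C.level v < k → C.level v < l → C.valAux B x k v = C.valAux B x l v
  | 0, _, _, h, _ => absurd h (Nat.not_lt_zero _)
  | _ + 1, 0, _, _, h => absurd h (Nat.not_lt_zero _)
  | k + 1, l + 1, v, hk, hl => by
    refine Gate.eval_congr B _ ?_
    rintro (i | u) hu
    · rfl
    · have := C.level_lt u v hu
      exact valAux_eq B x k l u (by omega) (by omega)

/-- Every gate computes its function of the values of its inputs. -/
theorem val_eq (B : Set (List Bool)) (x : Fin n → Bool) (v : C.V) :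
    C.val B x v = (C.gate v).eval B (Sum.elim x (C.val B x)) := by
  refine Gate.eval_congr B _ ?_
  rintro (i | u) hu
  · rfl
  · have := C.level_lt u v hu
    exact C.valAux_eq B x _ _ u (by omega) (by omega)

end Circuit

/-- A circuit family, with oracle language `B`, decides the binary language `K`. -/
def Decides (C : ∀ n : ℕ, Circuit n) (B K : Set (List Bool)) : Prop :=
  ∀ (n : ℕ) (x : Fin n → Bool), (C n).eval B x = true ↔ List.ofFn x ∈ K

/-- Constant depth and polynomial size. -/
def ConstDepthPolySize (C : ∀ n : ℕ, Circuit n) : Prop :=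
  ∃ (p : Polynomial ℕ) (d : ℕ), ∀ n : ℕ, (C n).size ≤ p.eval n ∧ (C n).DepthLE d

/-- `K ≤_cd B`: constant-depth truth-table reducibility of binary languages. The circuits have
AND, OR, NOT gates and oracle gates for `B`, and oracle gates are not nested. -/
def CDReducible (K B : Set (List Bool)) : Prop :=
  ∃ C : ∀ n : ℕ, Circuit n, ConstDepthPolySize C ∧ Decides C B K ∧
    ∀ n : ℕ, (C n).NoMaj ∧ (C n).OraclesNotNested

/-- Constant-depth (Turing) reducibility: the same, with oracle gates that may be nested. -/
def CDTuringReducible (K B : Set (List Bool)) : Prop :=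
  ∃ C : ∀ n : ℕ, Circuit n, ConstDepthPolySize C ∧ Decides C B K ∧ ∀ n : ℕ, (C n).NoMaj

/-- The class `TC⁰` of binary languages. -/
def TC0 : Set (Set (List Bool)) :=
  {K | ∃ C : ∀ n : ℕ, Circuit n, ConstDepthPolySize C ∧ Decides C ∅ K ∧
    ∀ n : ℕ, (C n).NoOracle}

/-- `EQUALITY`: as many zeros as ones. -/
def EQUALITY : Set (List Bool) := {w | w.count false = w.count true}

/-- A binary encoding of the letters of an alphabet by pairwise distinct blocks of bits of one
fixed positive size. -/
structure BlockEncoding (A : Type u) where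
  width : ℕ
  width_pos : 0 < width
  code : A → List Bool
  length_code : ∀ a, (code a).length = width
  injective : Function.Injective code

/-- The binary language that represents `L`. -/
def BlockEncoding.language {A : Type u} (enc : BlockEncoding A) (L : Set (List A)) :
    Set (List Bool) :=
  (fun w : List A => w.flatMap enc.code) '' L

end VPL

/-! Take a reachable idempotent `e` at which length-synchronicity fails, say through contexts (u, v)
and (u, v') over `e` with Δ(u) > 0 and |v| ≠ |v'|; the case of a common right word is symmetric. As
`e` is idempotent, the contexts over `e` are closed under nesting, so u^k can be closed by any
product of k factors from {v, v'}, where k ≥ 1. Reachability gives fixed words x, z, y with x u^k z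
v₁⋯v_k y ∈ L. If the number of factors differs from the exponent of u, the height of the word is
nonzero and the word is not in L. Thus L counts the factors (`replicate_left_mem_iff`).

Encode 0 by v^(2|v'|) and 1 by v'^(2|v|). Both blocks have 2|v||v'| letters, so a circuit can write
them at fixed positions, but they have different numbers of factors. For a word of length n the
total is (|v| + |v'|)n exactly if there are as many zeros as ones. One query to L therefore decides
EQUALITY (`cdReducible_EQUALITY`).

The other two claims follow by replacing gates by circuits. Replacing oracle gates shows that
truth-table reducibility is transitive (`CDReducible.trans`). A disjunction of EQUALITY queries
decides MAJORITY, and the resulting circuits with oracle L replace the majority gates of a TC⁰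
circuit (`cdTuringReducible_of_mem_TC0`). -/

namespace VPL

/-! ### Rewiring of gates and elementary facts about circuits. -/

namespace Gate

variable {α β : Type}

/-- Rewiring of a gate. -/
def map (f : α → β) : Gate α → Gate β
  | and l => and (l.map f)
  | or l => or (l.map f)
  | not a => not (f a)
  | maj l => maj (l.map f)
  | oracle l => oracle (l.map f)

theorem inputs_map (f : α → β) (g : Gate α) : (g.map f).inputs = g.inputs.map f := by
  cases g <;> rfl

theorem isMaj_map (f : α → β) (g : Gate α) : (g.map f).IsMaj ↔ g.IsMaj := by
  cases g <;> rfl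

theorem isOracle_map (f : α → β) (g : Gate α) : (g.map f).IsOracle ↔ g.IsOracle := by
  cases g <;> rfl

theorem eval_map (B : Set (List Bool)) (f : α → β) (h : β → Bool) (g : Gate α) :
    (g.map f).eval B h = g.eval B (h ∘ f) := by
  cases g <;> simp [map, eval, List.all_map, List.any_map, List.countP_map]

end Gate

namespace Circuit

variable {n : ℕ}

theorem level_lt_of_transGen (C : Circuit n) {u v : C.V} (h : Relation.TransGen C.Wire u v) :
    C.level u < C.level v := by
  induction h with
  | single h => exact C.level_lt _ _ h
  | tail _ h ih => exact ih.trans (C.level_lt _ _ h)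

theorem length_inputs_le_size (C : Circuit n) (v : C.V) : (C.gate v).inputs.length ≤ C.size :=
  (Nat.le_add_left _ 1).trans
    (Finset.single_le_sum (f := fun v => 1 + (C.gate v).inputs.length)
      (fun _ _ => Nat.zero_le _) (Finset.mem_univ v))

theorem card_le_size (C : Circuit n) : Fintype.card C.V ≤ C.size := by
  rw [size, Finset.sum_add_distrib]
  simp

/-! ### Replacing the gates of a circuit by circuits -/

section Subst

variable (C : Circuit n) (G : ∀ v : C.V, Circuit (C.gate v).inputs.length)

/-- The wires of the circuit that replaces the gate `v`, as wires of the resulting circuit. -/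
def port (v : C.V) :
    Fin (C.gate v).inputs.length ⊕ (G v).V → Fin n ⊕ (C.V ⊕ (Σ v : C.V, (G v).V)) :=
  Sum.elim (fun i => Sum.map id Sum.inl ((C.gate v).inputs.get i))
    (fun w => Sum.inr (Sum.inr ⟨v, w⟩))

variable {C G}

theorem port_eq_inr {v : C.V} {a : Fin (C.gate v).inputs.length ⊕ (G v).V}
    {b : C.V ⊕ (Σ v : C.V, (G v).V)} (h : C.port G v a = Sum.inr b) :
    (∃ u : C.V, C.Wire u v ∧ b = Sum.inl u) ∨ ∃ w, a = Sum.inr w ∧ b = Sum.inr ⟨v, w⟩ := by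
  rcases a with i | w
  · left
    simp only [port, Sum.elim_inl] at h
    rcases hi : (C.gate v).inputs.get i with j | u
    · rw [hi] at h
      simp at h
    · rw [hi] at h
      refine ⟨u, ?_, ?_⟩
      · rw [Wire, ← hi]
        exact List.get_mem _ _
      · simpa using h.symm
  · right
    simp only [port, Sum.elim_inr, Sum.inr.injEq] at h
    exact ⟨w, rfl, h.symm⟩

variable (C G)

/-- The circuit in which every gate `v` is replaced by a circuit `G v`. -/
@[reducible] def subst (D : ℕ) (hG : ∀ v, (G v).DepthLE D) : Circuit n where
  V := C.V ⊕ (Σ v : C.V, (G v).V)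
  -- The AND gate with one input relays the output of `G v`, so that the old wires from `v` have a
  -- source even if that output is an input node.
  gate := Sum.elim (fun v => .and [C.port G v (G v).out])
    (fun p => ((G p.1).gate p.2).map (C.port G p.1))
  -- Each old level becomes a band of `D + 1` levels: the inner gates use the first `D`, the relay
  -- the last.
  level := Sum.elim (fun v => C.level v * (D + 1) + D)
    (fun p => C.level p.1 * (D + 1) + (G p.1).level p.2)
  level_lt := by
    have hmul : ∀ u v : C.V, C.Wire u v →
        C.level u * (D + 1) + D < C.level v * (D + 1) := fun u v h => by
      have := Nat.mul_le_mul_right (D + 1) (Nat.succ_le_of_lt (C.level_lt u v h))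
      rw [Nat.succ_mul] at this
      omega
    rintro b (v | ⟨v, w⟩) h
    · simp only [Sum.elim_inl, Gate.inputs, List.mem_singleton] at h
      rcases port_eq_inr h.symm with ⟨u, hu, rfl⟩ | ⟨w, hw, rfl⟩
      · simpa using (hmul u v hu).trans_le (Nat.le_add_right _ D)
      · simpa using hG v w
    · simp only [Sum.elim_inr, Gate.inputs_map, List.mem_map] at h
      obtain ⟨a, ha, h⟩ := h
      rcases port_eq_inr h with ⟨u, hu, rfl⟩ | ⟨w', rfl, rfl⟩
      · simpa using (hmul u v hu).trans_le (Nat.le_add_right _ _)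
      · simpa using (G v).level_lt _ _ ha
  out := Sum.map id Sum.inl C.out

variable (D : ℕ) (hG : ∀ v, (G v).DepthLE D)

theorem val_subst_inr (B B' : Set (List Bool)) (x : Fin n → Bool) (v : C.V)
    (hv : ∀ u, C.Wire u v → (C.subst G D hG).val B' x (Sum.inl u) = C.val B x u) (k : ℕ) :
    ∀ w : (G v).V, (G v).level w < k →
      (C.subst G D hG).val B' x (Sum.inr ⟨v, w⟩) =
        (G v).val B' (fun i => Sum.elim x (C.val B x) ((C.gate v).inputs.get i)) w := by
  induction k with
  | zero => intro w h; omega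
  | succ k ih =>
    intro w hw
    rw [val_eq, val_eq]
    change Gate.eval B' _ (((G v).gate w).map (C.port G v)) = _
    rw [Gate.eval_map]
    refine Gate.eval_congr _ _ ?_
    rintro (i | w') hw'
    · simp only [Function.comp_apply, port, Sum.elim_inl]
      rcases hi : (C.gate v).inputs.get i with j | u
      · rfl
      · refine hv u ?_
        rw [Wire, ← hi]
        exact List.get_mem _ _
    · have := (G v).level_lt _ _ hw'
      exact ih w' (by omega)

/-- Induction on the level in `C`: once the relays of all predecessors of `v` are correct, `G v`
receives the right inputs. The oracle may change from `B` to `B'`, since `hB` compares `G v` under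
`B'` with the gate under `B`. -/
theorem val_subst_inl (B B' : Set (List Bool)) (x : Fin n → Bool)
    (hB : ∀ (v : C.V) (f : Fin n ⊕ C.V → Bool),
      (G v).eval B' (fun i => f ((C.gate v).inputs.get i)) = (C.gate v).eval B f) (k : ℕ) :
    ∀ v : C.V, C.level v < k → (C.subst G D hG).val B' x (Sum.inl v) = C.val B x v := by
  induction k with
  | zero => intro w h; omega
  | succ k ih =>
    intro v hv
    have hu : ∀ u, C.Wire u v → (C.subst G D hG).val B' x (Sum.inl u) = C.val B x u :=
      fun u hu => ih u (by have := C.level_lt u v hu; omega)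
    rw [C.val_eq, ← hB v, val_eq]
    change Gate.eval B' _ (.and [C.port G v (G v).out]) = _
    simp only [Gate.eval, List.all_cons, List.all_nil, Bool.and_true, Circuit.eval]
    rcases (G v).out with i | w
    · simp only [port, Sum.elim_inl]
      rcases hi : (C.gate v).inputs.get i with j | u
      · rfl
      · refine hu u ?_
        rw [Wire, ← hi]
        exact List.get_mem _ _
    · exact C.val_subst_inr G D hG B B' x v hu _ w (Nat.lt_succ_self _)

theorem eval_subst (B B' : Set (List Bool)) (x : Fin n → Bool)
    (hB : ∀ (v : C.V) (f : Fin n ⊕ C.V → Bool),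
      (G v).eval B' (fun i => f ((C.gate v).inputs.get i)) = (C.gate v).eval B f) :
    (C.subst G D hG).eval B' x = C.eval B x := by
  unfold Circuit.eval
  change Sum.elim x _ (Sum.map id Sum.inl C.out) = _
  rcases C.out with i | v
  · rfl
  · exact C.val_subst_inl G D hG B B' x hB _ v (Nat.lt_succ_self _)

theorem size_subst_le (s : ℕ) (hs : ∀ v, (G v).size ≤ s) :
    (C.subst G D hG).size ≤ C.size * (2 + s) := by
  have h : (C.subst G D hG).size = ∑ v : C.V, (2 + (G v).size) := by
    change ∑ b : C.V ⊕ (Σ v : C.V, (G v).V), _ = _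
    rw [Fintype.sum_sum_type, Fintype.sum_sigma, ← Finset.sum_add_distrib]
    refine Finset.sum_congr rfl fun v _ => ?_
    congr 1
    refine Finset.sum_congr rfl fun w _ => ?_
    change 1 + (((G v).gate w).map (C.port G v)).inputs.length = _
    rw [Gate.inputs_map, List.length_map]
  rw [h]
  refine (Finset.sum_le_card_nsmul _ _ (2 + s) fun v _ => Nat.add_le_add_left (hs v) 2).trans ?_
  exact Nat.mul_le_mul_right _ C.card_le_size

theorem depthLE_subst {d : ℕ} (h : C.DepthLE d) :
    (C.subst G D hG).DepthLE (d * (D + 1)) := by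
  have hmul : ∀ v : C.V, C.level v * (D + 1) + D < d * (D + 1) := fun v => by
    have := Nat.mul_le_mul_right (D + 1) (Nat.succ_le_of_lt (h v))
    rw [Nat.succ_mul] at this
    omega
  rintro (v | ⟨v, w⟩)
  · exact hmul v
  · exact (Nat.add_le_add_left (hG v w).le _).trans_lt (hmul v)

theorem noMaj_subst (h : ∀ v, (G v).NoMaj) : (C.subst G D hG).NoMaj := by
  rintro (v | ⟨v, w⟩) hm
  · exact hm
  · exact h v w ((Gate.isMaj_map _ _).1 hm)

/-- A block can be left only through its relay, along a wire of `C`. Hence a path that leaves the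
block projects to a nonempty path of `C`. -/
theorem transGen_subst {v : C.V} {w : (G v).V} {b : (C.subst G D hG).V}
    (h : Relation.TransGen (C.subst G D hG).Wire (Sum.inr ⟨v, w⟩) b) :
    (b = Sum.inl v ∨ ∃ w', b = Sum.inr ⟨v, w'⟩ ∧ Relation.TransGen (G v).Wire w w') ∨
      Relation.TransGen C.Wire v (Sum.elim id Sigma.fst b) := by
  have step : ∀ a b : (C.subst G D hG).V, (C.subst G D hG).Wire a b →
      (∃ u, a = Sum.inl u ∧ C.Wire u (Sum.elim id Sigma.fst b)) ∨
      (∃ v w, a = Sum.inr ⟨v, w⟩ ∧ (b = Sum.inl v ∨ ∃ w', b = Sum.inr ⟨v, w'⟩ ∧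
        (G v).Wire w w')) := by
    rintro a (v | ⟨v, w⟩) h
    · have h : Sum.inr a ∈ [C.port G v (G v).out] := h
      rw [List.mem_singleton] at h
      rcases port_eq_inr h.symm with ⟨u, hu, rfl⟩ | ⟨w, hw, rfl⟩
      · exact .inl ⟨u, rfl, hu⟩
      · exact .inr ⟨v, w, rfl, .inl rfl⟩
    · have h : Sum.inr a ∈ (((G v).gate w).map (C.port G v)).inputs := h
      rw [Gate.inputs_map, List.mem_map] at h
      obtain ⟨c, hc, h⟩ := h
      rcases port_eq_inr h with ⟨u, hu, rfl⟩ | ⟨w', rfl, rfl⟩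
      · exact .inl ⟨u, rfl, hu⟩
      · exact .inr ⟨v, w', rfl, .inr ⟨w, rfl, hc⟩⟩
  induction h with
  | single hs =>
    rcases step _ _ hs with ⟨u, hu, -⟩ | ⟨v', w', hvw, h⟩
    · cases hu
    · cases hvw
      rcases h with rfl | ⟨w', rfl, h⟩
      · exact .inl (.inl rfl)
      · exact .inl (.inr ⟨w', rfl, .single h⟩)
  | tail _ hs ih =>
    rcases step _ _ hs with ⟨u, rfl, h⟩ | ⟨v', w', rfl, h⟩
    · right
      rcases ih with (hu | ⟨w', hw, -⟩) | ih
      · cases hu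
        exact .single h
      · cases hw
      · exact ih.tail h
    · rcases ih with (hu | ⟨w'', hw, ih⟩) | ih
      · cases hu
      · cases hw
        rcases h with rfl | ⟨w', rfl, h⟩
        · exact .inl (.inl rfl)
        · exact .inl (.inr ⟨w', rfl, ih.tail h⟩)
      · right
        rcases h with rfl | ⟨w', rfl, h⟩ <;> exact ih

/-- A path between oracle gates either stays in one block, against `h`, or projects to a path of `C`
whose ends are oracle gates by `ho`, against `hC`. -/
theorem oraclesNotNested_subst (hC : C.OraclesNotNested) (h : ∀ v, (G v).OraclesNotNested)
    (ho : ∀ v, ¬ (C.gate v).IsOracle → (G v).NoOracle) :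
    (C.subst G D hG).OraclesNotNested := by
  rintro (v | ⟨v, w⟩) (v' | ⟨v', w'⟩) hv hv' hp
  · exact hv
  · exact hv
  · exact hv'
  · have hw := (Gate.isOracle_map _ _).1 hv
    have hw' := (Gate.isOracle_map _ _).1 hv'
    rcases C.transGen_subst G D hG hp with (hb | ⟨w'', hb, hr⟩) | hp
    · cases hb
    · cases hb
      exact h v w _ hw hw' hr
    · exact hC v v' (by_contra fun hn => ho v hn w hw) (by_contra fun hn => ho v' hn w' hw') hp

end Subst

/-- The circuit with a single gate. -/
@[reducible] def ofGate (g : Gate (Fin n)) : Circuit n where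
  V := Unit
  gate _ := g.map Sum.inl
  level _ := 0
  level_lt := by
    intro u v h
    rw [Gate.inputs_map, List.mem_map] at h
    obtain ⟨_, _, h⟩ := h
    cases h
  out := Sum.inr ()

theorem eval_ofGate (B : Set (List Bool)) (g : Gate (Fin n)) (x : Fin n → Bool) :
    (ofGate g).eval B x = g.eval B x := by
  change (ofGate g).val B x () = _
  rw [val_eq]
  exact Gate.eval_map _ _ _ _

theorem size_ofGate (g : Gate (Fin n)) : (ofGate g).size = 1 + g.inputs.length := by
  change ∑ _ : Unit, (1 + (g.map Sum.inl).inputs.length) = _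
  simp [Gate.inputs_map]

end Circuit

/-! ### Polynomial bounds -/

theorem polynomial_eval_mono (p : Polynomial ℕ) : Monotone fun n : ℕ => p.eval n := by
  intro m n h
  induction p using Polynomial.induction_on' with
  | add p q hp hq => simpa using Nat.add_le_add hp hq
  | monomial k a => simpa using Nat.mul_le_mul_left a (Nat.pow_le_pow_left h k)

/-- Polynomially bounded functions. -/
def PolyBounded (f : ℕ → ℕ) : Prop := ∃ p : Polynomial ℕ, ∀ n, f n ≤ p.eval n

namespace PolyBounded

variable {f g : ℕ → ℕ}

theorem const (c : ℕ) : PolyBounded fun _ => c := ⟨Polynomial.C c, fun n => by simp⟩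

theorem id : PolyBounded fun n => n := ⟨Polynomial.X, fun n => by simp⟩

theorem add (hf : PolyBounded f) (hg : PolyBounded g) : PolyBounded fun n => f n + g n := by
  obtain ⟨p, hp⟩ := hf
  obtain ⟨q, hq⟩ := hg
  exact ⟨p + q, fun n => by simpa using Nat.add_le_add (hp n) (hq n)⟩

theorem mul (hf : PolyBounded f) (hg : PolyBounded g) : PolyBounded fun n => f n * g n := by
  obtain ⟨p, hp⟩ := hf
  obtain ⟨q, hq⟩ := hg
  exact ⟨p * q, fun n => by simpa using Nat.mul_le_mul (hp n) (hq n)⟩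

theorem mono (hf : PolyBounded f) (h : ∀ n, g n ≤ f n) : PolyBounded g :=
  hf.imp fun _ hp n => (h n).trans (hp n)

end PolyBounded

/-! ### Gates as circuits -/

namespace Gate

variable {α : Type}

/-- A gate with its inputs numbered. -/
def numbered : (g : Gate α) → Gate (Fin g.inputs.length)
  | and l => and (List.finRange l.length)
  | or l => or (List.finRange l.length)
  | not _ => not (0 : Fin 1)
  | maj l => maj (List.finRange l.length)
  | oracle l => oracle (List.finRange l.length)

theorem map_numbered (g : Gate α) : g.numbered.map g.inputs.get = g := by
  cases g with
  | not a => rfl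
  | and l => exact congrArg and (List.map_get_finRange l)
  | or l => exact congrArg or (List.map_get_finRange l)
  | maj l => exact congrArg maj (List.map_get_finRange l)
  | oracle l => exact congrArg oracle (List.map_get_finRange l)

theorem isMaj_numbered (g : Gate α) : g.numbered.IsMaj ↔ g.IsMaj := by
  cases g <;> rfl

theorem isOracle_numbered (g : Gate α) : g.numbered.IsOracle ↔ g.IsOracle := by
  cases g <;> rfl

theorem length_inputs_numbered (g : Gate α) : g.numbered.inputs.length = g.inputs.length := by
  conv_rhs => rw [← map_numbered g]
  rw [inputs_map, List.length_map]

theorem eval_numbered (B : Set (List Bool)) (g : Gate α) (f : α → Bool) :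
    g.numbered.eval B (fun i => f (g.inputs.get i)) = g.eval B f := by
  conv_rhs => rw [← map_numbered g]
  rw [eval_map]
  rfl

theorem eval_eq_of_not_isOracle {g : Gate α} (h : ¬ g.IsOracle) (B B' : Set (List Bool))
    (f : α → Bool) : g.eval B f = g.eval B' f := by
  cases g with
  | oracle l => exact absurd trivial h
  | _ => rfl

theorem ofFn_comp_get {β : Type} (l : List α) (f : α → β) :
    List.ofFn (fun i => f (l.get i)) = l.map f := by
  rw [← List.ofFn_get (l.map f)]
  refine List.ext_getElem (by simp) (by simp)

open Classical in
/-- The circuit of the family `F` if the gate satisfies `P`, and the gate itself otherwise. -/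
noncomputable def gadget (P : Gate α → Prop) (F : ∀ m : ℕ, Circuit m) (g : Gate α) :
    Circuit g.inputs.length :=
  if P g then F g.inputs.length else .ofGate g.numbered

variable {P : Gate α → Prop} {F : ∀ m : ℕ, Circuit m} {g : Gate α}

theorem gadget_of_pos (h : P g) : g.gadget P F = F g.inputs.length := if_pos h

theorem gadget_of_neg (h : ¬ P g) : g.gadget P F = .ofGate g.numbered := if_neg h

theorem size_gadget_le :
    (g.gadget P F).size ≤ (F g.inputs.length).size + (1 + g.inputs.length) := by
  by_cases h : P g
  · rw [gadget_of_pos h]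
    omega
  · rw [gadget_of_neg h, Circuit.size_ofGate, length_inputs_numbered]
    omega

/-- The extra level makes room for the single-gate circuit when `D = 0`. -/
theorem depthLE_gadget {D : ℕ} (hF : ∀ m, (F m).DepthLE D) : (g.gadget P F).DepthLE (D + 1) := by
  by_cases h : P g
  · rw [gadget_of_pos h]
    exact fun v => (hF _ v).trans (Nat.lt_succ_self D)
  · rw [gadget_of_neg h]
    exact fun v => Nat.succ_pos D

theorem noMaj_gadget (hF : ∀ m, (F m).NoMaj) (hg : ¬ P g → ¬ g.IsMaj) :
    (g.gadget P F).NoMaj := by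
  by_cases h : P g
  · rw [gadget_of_pos h]
    exact hF _
  · rw [gadget_of_neg h]
    exact fun v hv => hg h ((isMaj_numbered g).1 ((isMaj_map _ _).1 hv))

theorem noOracle_gadget (h : ¬ P g) (hg : ¬ g.IsOracle) : (g.gadget P F).NoOracle := by
  rw [gadget_of_neg h]
  exact fun v hv => hg ((isOracle_numbered g).1 ((isOracle_map _ _).1 hv))

end Gate

/-! ### Composition of reductions -/

/-- The fan-in of a gate is at most the circuit size p(n), so by monotonicity each inserted circuit
of `F` has size at most q(p(n)). `P` selects the gates to replace and is polymorphic because the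
node type varies with the circuit. -/
theorem constDepthPolySize_subst {C : ∀ n : ℕ, Circuit n} (hC : ConstDepthPolySize C)
    {F : ∀ m : ℕ, Circuit m} (hF : ConstDepthPolySize F) {B B' K : Set (List Bool)}
    (hK : Decides C B K) (P : ∀ {α : Type}, Gate α → Prop)
    (hP : ∀ n (v : (C n).V) (f : Fin n ⊕ (C n).V → Bool),
      (((C n).gate v).gadget P F).eval B' (fun i => f (((C n).gate v).inputs.get i)) =
        ((C n).gate v).eval B f) :
    ∃ (D : ℕ) (hD : ∀ n (v : (C n).V), (((C n).gate v).gadget P F).DepthLE D),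
      ConstDepthPolySize (fun n =>
        (C n).subst (fun v => ((C n).gate v).gadget P F) D (hD n)) ∧
      Decides (fun n => (C n).subst (fun v => ((C n).gate v).gadget P F) D (hD n)) B' K := by
  obtain ⟨p, d, hC⟩ := hC
  obtain ⟨q, D, hF⟩ := hF
  refine ⟨D + 1, fun n v => Gate.depthLE_gadget fun m => (hF m).2,
    ⟨p * (2 + (q.comp p + (1 + p))), d * (D + 1 + 1), fun n => ⟨?_, ?_⟩⟩, fun n x => ?_⟩
  · refine ((C n).size_subst_le _ _ _ (q.eval (p.eval n) + (1 + p.eval n)) fun v => ?_).trans ?_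
    · have hv := ((C n).length_inputs_le_size v).trans (hC n).1
      refine Gate.size_gadget_le.trans (Nat.add_le_add ((hF _).1.trans ?_) (by omega))
      exact polynomial_eval_mono q hv
    · refine (Nat.mul_le_mul_right _ (hC n).1).trans (le_of_eq ?_)
      simp
  · exact (C n).depthLE_subst _ _ _ (hC n).2
  · rw [← hK n x, (C n).eval_subst _ _ _ B B' x (hP n)]

theorem CDReducible.trans {K B B' : Set (List Bool)} (hK : CDReducible K B)
    (hB : CDReducible B B') : CDReducible K B' := by
  obtain ⟨C, hC, hCK, hC'⟩ := hK
  obtain ⟨F, hF, hFB, hF'⟩ := hB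
  obtain ⟨D, hD, h1, h2⟩ := constDepthPolySize_subst (B' := B') hC hF hCK Gate.IsOracle (by
    intro n v f
    by_cases h : ((C n).gate v).IsOracle
    · rw [Gate.gadget_of_pos h, Bool.eq_iff_iff, hFB, Gate.ofFn_comp_get]
      cases hg : (C n).gate v with
      | oracle l => simp [Gate.eval, Gate.inputs]
      | _ => rw [hg] at h; exact h.elim
    · rw [Gate.gadget_of_neg h, Circuit.eval_ofGate, Gate.eval_numbered,
        Gate.eval_eq_of_not_isOracle h B' B])
  refine ⟨_, h1, h2, fun n => ⟨?_, ?_⟩⟩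
  · exact (C n).noMaj_subst _ _ _ fun v =>
      Gate.noMaj_gadget (fun m => (hF' m).1) fun _ => (hC' n).1 v
  · refine (C n).oraclesNotNested_subst _ _ _ (hC' n).2 (fun v => ?_)
      fun v hv => Gate.noOracle_gadget hv hv
    by_cases h : ((C n).gate v).IsOracle
    · rw [Gate.gadget_of_pos h]
      exact (hF' _).2
    · exact fun a b ha _ _ => Gate.noOracle_gadget h h a ha

/-- The words in which more than half of the letters are ones. -/
def MAJORITY : Set (List Bool) := {w | w.length < 2 * w.count true}

/-- Majority gates of a TC⁰ circuit may be nested, and so may the oracle gates that replace them;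
only a Turing reduction results. -/
theorem cdTuringReducible_of_mem_TC0 {K B : Set (List Bool)} (hK : K ∈ TC0)
    (hB : CDTuringReducible MAJORITY B) : CDTuringReducible K B := by
  obtain ⟨C, hC, hCK, hC'⟩ := hK
  obtain ⟨F, hF, hFB, hF'⟩ := hB
  obtain ⟨D, hD, h1, h2⟩ := constDepthPolySize_subst (B' := B) hC hF hCK Gate.IsMaj (by
    intro n v f
    by_cases h : ((C n).gate v).IsMaj
    · rw [Gate.gadget_of_pos h, Bool.eq_iff_iff, hFB, Gate.ofFn_comp_get]
      cases hg : (C n).gate v with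
      | maj l =>
        simp only [Gate.eval, Gate.inputs, MAJORITY, Set.mem_ofPred_eq, List.length_map,
          List.count, List.countP_map, decide_eq_true_eq]
        rw [List.countP_congr (q := f) (fun a _ => by simp)]
      | _ => rw [hg] at h; exact h.elim
    · rw [Gate.gadget_of_neg h, Circuit.eval_ofGate, Gate.eval_numbered,
        Gate.eval_eq_of_not_isOracle (hC' n v) B ∅])
  exact ⟨_, h1, h2, fun n => (C n).noMaj_subst _ _ _ fun v => Gate.noMaj_gadget hF' id⟩

/-! ### Reductions by lists of oracle queries -/

/-- Constants, input bits and negated input bits. -/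
inductive Literal (n : ℕ) where
  | const (b : Bool)
  | pos (i : Fin n)
  | neg (i : Fin n)

namespace Literal

variable {n : ℕ}

/-- The value of a literal. -/
def eval (x : Fin n → Bool) : Literal n → Bool
  | const b => b
  | pos i => x i
  | neg i => !(x i)

/-- The node of `queryCircuit` that computes a literal. -/
def node {V : Type} : Literal n → Fin n ⊕ ((Bool ⊕ Fin n) ⊕ V)
  | const b => .inr (.inl (.inl b))
  | pos i => .inl i
  | neg i => .inr (.inl (.inr i))

/-- The literal with value `b₁` if the `i`-th input bit is one, and `b₀` otherwise. -/
def select (i : Fin n) : Bool → Bool → Literal n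
  | false, true => pos i
  | true, false => neg i
  | b, _ => const b

theorem eval_select (x : Fin n → Bool) (i : Fin n) (b₀ b₁ : Bool) :
    (select i b₀ b₁).eval x = bif x i then b₁ else b₀ := by
  cases b₀ <;> cases b₁ <;> simp [select, eval]

theorem map_eval_zipWith_select (x : Fin n → Bool) (i : Fin n) :
    ∀ c₀ c₁ : List Bool, c₀.length = c₁.length →
      (List.zipWith (select i) c₀ c₁).map (eval x) = bif x i then c₁ else c₀
  | [], [], _ => by cases x i <;> rfl
  | a :: c₀, b :: c₁, h => by
    rw [List.zipWith_cons_cons, List.map_cons, map_eval_zipWith_select x i c₀ c₁ (by simpa using h),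
      eval_select]
    cases x i <;> rfl

end Literal

section Query

variable {n : ℕ}

/-- The gates of `queryCircuit`: constants, negations, one oracle gate for every query, and the
output gate. -/
def queryGate (W : List (List (Literal n))) :
    (Bool ⊕ Fin n) ⊕ Option (Fin W.length) →
      Gate (Fin n ⊕ ((Bool ⊕ Fin n) ⊕ Option (Fin W.length)))
  | .inl (.inl true) => .and []
  | .inl (.inl false) => .or []
  | .inl (.inr i) => .not (.inl i)
  | .inr (some j) => .oracle ((W.get j).map Literal.node)
  | .inr none => .or ((List.finRange W.length).map fun j => .inr (.inr (some j)))

/-- The disjunction of the oracle queries in the list `W`. -/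
@[reducible] def queryCircuit (W : List (List (Literal n))) : Circuit n where
  V := (Bool ⊕ Fin n) ⊕ Option (Fin W.length)
  gate := queryGate W
  level
    | .inl _ => 0
    | .inr (some _) => 1
    | .inr none => 2
  level_lt := by
    rintro u (((_ | _) | i) | (_ | j)) h
    · simp [queryGate, Gate.inputs] at h
    · simp [queryGate, Gate.inputs] at h
    · simp [queryGate, Gate.inputs] at h
    · simp only [queryGate, Gate.inputs, List.mem_map] at h
      obtain ⟨j, -, h⟩ := h
      cases h
      exact Nat.lt_succ_self _
    · simp only [queryGate, Gate.inputs, List.mem_map] at h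
      obtain ⟨b | i | i, -, h⟩ := h <;> cases h <;> exact Nat.lt_succ_self _
  out := .inr (.inr none)

variable (W : List (List (Literal n)))

theorem depthLE_queryCircuit : (queryCircuit W).DepthLE 3 := by
  rintro (_ | (_ | _))
  · exact Nat.succ_pos _
  · exact Nat.lt_succ_self _
  · exact Nat.succ_lt_succ (Nat.succ_pos _)

theorem noMaj_queryCircuit : (queryCircuit W).NoMaj := by
  rintro (((_ | _) | i) | (_ | j)) h <;> exact h

theorem oraclesNotNested_queryCircuit : (queryCircuit W).OraclesNotNested := by
  have key : ∀ v : (queryCircuit W).V, ((queryCircuit W).gate v).IsOracle →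
      (queryCircuit W).level v = 1 := by
    rintro (((_ | _) | i) | (_ | j)) h
    · exact h.elim
    · exact h.elim
    · exact h.elim
    · exact h.elim
    · rfl
  intro u v hu hv h
  have := (queryCircuit W).level_lt_of_transGen h
  rw [key u hu, key v hv] at this
  omega

theorem size_queryCircuit_le {s : ℕ} (hs : ∀ w ∈ W, w.length ≤ s) :
    (queryCircuit W).size ≤ 2 + n * 2 + (1 + W.length) + W.length * (1 + s) := by
  have h : (queryCircuit W).size =
      2 + n * 2 + ((1 + W.length) + ∑ j : Fin W.length, (1 + (W.get j).length)) := by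
    change ∑ v : (Bool ⊕ Fin n) ⊕ Option (Fin W.length), _ = _
    rw [Fintype.sum_sum_type, Fintype.sum_sum_type, Fintype.sum_option]
    simp [queryGate, Gate.inputs]
  have h' : ∑ j : Fin W.length, (1 + (W.get j).length) ≤ W.length * (1 + s) := by
    refine (Finset.sum_le_card_nsmul _ _ (1 + s) fun j _ =>
      Nat.add_le_add_left (hs _ (List.get_mem W j)) 1).trans ?_
    simp
  omega

theorem eval_queryCircuit (B : Set (List Bool)) (x : Fin n → Bool) :
    (queryCircuit W).eval B x = true ↔ ∃ w ∈ W, w.map (Literal.eval x) ∈ B := by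
  have hlit : ∀ a : Literal n,
      Sum.elim x ((queryCircuit W).val B x) a.node = a.eval x := by
    rintro ((_ | _) | i | i)
    · exact (Circuit.val_eq _ _ _ _).trans rfl
    · exact (Circuit.val_eq _ _ _ _).trans rfl
    · rfl
    · exact (Circuit.val_eq _ _ _ _).trans rfl
  have hor : ∀ j, (queryCircuit W).val B x (.inr (some j)) = true ↔
      (W.get j).map (Literal.eval x) ∈ B := by
    intro j
    rw [Circuit.val_eq]
    simp only [queryGate, Gate.eval, List.map_map, decide_eq_true_eq]
    exact iff_of_eq (congrArg (· ∈ B) (List.map_congr_left fun a _ => hlit a))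
  change (queryCircuit W).val B x (.inr none) = true ↔ _
  rw [Circuit.val_eq]
  simp only [queryGate, Gate.eval, List.any_map, List.any_eq_true, List.mem_finRange, true_and,
    Function.comp_apply, Sum.elim_inr, hor]
  constructor
  · rintro ⟨j, hj⟩
    exact ⟨_, List.get_mem W j, hj⟩
  · rintro ⟨w, hw, h⟩
    obtain ⟨j, rfl⟩ := List.get_of_mem hw
    exact ⟨j, h⟩

end Query

theorem cdReducible_of_queries {K B : Set (List Bool)} (W : ∀ n : ℕ, List (List (Literal n)))
    {s : ℕ → ℕ} (hs : PolyBounded s) (hW : ∀ n, (W n).length ≤ s n)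
    (hW' : ∀ n, ∀ w ∈ W n, w.length ≤ s n)
    (hK : ∀ (n : ℕ) (x : Fin n → Bool),
      List.ofFn x ∈ K ↔ ∃ w ∈ W n, w.map (Literal.eval x) ∈ B) :
    CDReducible K B := by
  refine ⟨fun n => queryCircuit (W n), ?_, fun n x => ?_, fun n =>
    ⟨noMaj_queryCircuit _, oraclesNotNested_queryCircuit _⟩⟩
  · obtain ⟨p, hp⟩ := (((PolyBounded.const 2).add (PolyBounded.id.mul (.const 2))).add
      ((PolyBounded.const 1).add hs)).add (hs.mul ((PolyBounded.const 1).add hs))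
    refine ⟨p, 3, fun n => ⟨?_, depthLE_queryCircuit _⟩⟩
    refine (size_queryCircuit_le _ (hW' n)).trans (le_trans ?_ (hp n))
    change _ ≤ 2 + n * 2 + (1 + s n) + s n * (1 + s n)
    have := Nat.mul_le_mul_right (1 + s n) (hW n)
    have := hW n
    omega
  · rw [eval_queryCircuit, hK]

/-- Ones outnumber zeros exactly if appending some j + 1 zeros, with j < n, balances the word. -/
theorem cdReducible_MAJORITY_EQUALITY : CDReducible MAJORITY EQUALITY := by
  refine cdReducible_of_queries (fun n => (List.range n).map fun j =>
    (List.finRange n).map .pos ++ List.replicate (j + 1) (.const false))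
    (s := fun n => n + n) (PolyBounded.id.add .id) (fun n => by simp) ?_ ?_
  · intro n w hw
    obtain ⟨j, hj, rfl⟩ := List.mem_map.1 hw
    have := List.mem_range.1 hj
    simp
    omega
  · intro n x
    have hx : (List.finRange n).map (Literal.eval x ∘ Literal.pos) = List.ofFn x :=
      (List.ofFn_eq_map (f := x)).symm
    have hlen : (List.ofFn x).count false + (List.ofFn x).count true = n := by
      rw [List.count_false_add_count_true, List.length_ofFn]
    have hEQ : ∀ j, ((List.finRange n).map Literal.pos ++
        List.replicate (j + 1) (Literal.const false)).map (Literal.eval x) ∈ EQUALITY ↔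
        (List.ofFn x).count false + (j + 1) = (List.ofFn x).count true := by
      intro j
      rw [List.map_append, List.map_map, hx, List.map_replicate]
      simp [EQUALITY, Literal.eval, List.count_replicate]
    simp only [List.mem_map, List.mem_range, exists_exists_and_eq_and, hEQ]
    rw [MAJORITY, Set.mem_ofPred_eq, List.length_ofFn]
    constructor
    · intro h
      exact ⟨(List.ofFn x).count true - (List.ofFn x).count false - 1, by omega, by omega⟩
    · rintro ⟨j, hj, h⟩
      omega

/-- A reduction that maps the two bits to words of the same length, and adds a prefix and a
suffix. -/
theorem cdReducible_of_blocks {A : Type u} (enc : BlockEncoding A) {K : Set (List Bool)}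
    {L : Set (List A)} (p q : ℕ → List A) (h : Bool → List A)
    (hp : PolyBounded fun n => (p n).length) (hq : PolyBounded fun n => (q n).length)
    (hh : (h false).length = (h true).length)
    (hK : ∀ w : List Bool, w ∈ K ↔ p w.length ++ w.flatMap h ++ q w.length ∈ L) :
    CDReducible K (enc.language L) := by
  have hlen : ∀ w : List A, (w.flatMap enc.code).length = w.length * enc.width := by
    intro w
    simp [List.length_flatMap, enc.length_code]
  -- Blocks of one fixed length can be split off uniquely; positivity of the width excludes that a
  -- nonempty word is encoded by the empty one.
  have hinj : ∀ w : List A, w.flatMap enc.code ∈ enc.language L ↔ w ∈ L := by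
    have hi : ∀ w w' : List A, w.flatMap enc.code = w'.flatMap enc.code → w = w' := by
      intro w
      induction w with
      | nil =>
        intro w' h
        have := congrArg List.length h
        rw [hlen, hlen] at this
        have hw := enc.width_pos
        have : w'.length = 0 := by
          rcases Nat.mul_eq_zero.1 (this.symm.trans (by simp)) with h | h <;> omega
        exact (List.length_eq_zero_iff.1 this).symm
      | cons a w ih =>
        rintro (_ | ⟨b, w'⟩) h
        · have := congrArg List.length h
          rw [hlen, hlen] at this
          have hw := enc.width_pos
          rcases Nat.mul_eq_zero.1 (this.trans (by simp)) with h | h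
          · simp at h
          · omega
        · rw [List.flatMap_cons, List.flatMap_cons] at h
          obtain ⟨h₁, h₂⟩ := List.append_inj h (by rw [enc.length_code, enc.length_code])
          rw [enc.injective h₁, ih w' h₂]
    intro w
    constructor
    · rintro ⟨w', hw', h⟩
      exact hi _ _ h ▸ hw'
    · exact fun hw => ⟨w, hw, rfl⟩
  let c : Bool → List Bool := fun b => (h b).flatMap enc.code
  have hc : (c false).length = (c true).length := by simp only [c, hlen, hh]
  -- A single query suffices: as both blocks have the same length, every position of the query
  -- depends on at most one input bit.
  refine cdReducible_of_queries (fun n => [((p n).flatMap enc.code).map .const ++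
    (List.finRange n).flatMap (fun i => List.zipWith (Literal.select i) (c false) (c true)) ++
    ((q n).flatMap enc.code).map .const])
    (s := fun n => 1 + (((p n).length * enc.width + n * (c false).length) +
      (q n).length * enc.width))
    ((PolyBounded.const 1).add (((hp.mul (.const _)).add (PolyBounded.id.mul (.const _))).add
      (hq.mul (.const _)))) (fun n => ?_) (fun n w hw => ?_) (fun n x => ?_)
  · simp
  · rw [List.mem_singleton] at hw
    subst hw
    simp only [List.length_append, List.length_map, hlen, List.length_flatMap,
      List.length_zipWith, ← hc, min_self, List.map_const', List.length_finRange,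
      List.sum_replicate, smul_eq_mul]
    omega
  · have hconst : ∀ l : List Bool, (l.map Literal.const).map (Literal.eval x) = l := by
      intro l
      rw [List.map_map]
      exact List.map_id l
    rw [hK, ← hinj]
    simp only [List.mem_singleton, exists_eq_left, List.map_append, hconst, List.map_flatMap,
      Literal.map_eval_zipWith_select x _ _ _ hc, List.length_ofFn, List.flatMap_append,
      List.flatMap_assoc]
    rw [List.ofFn_eq_map, List.flatMap_map]
    have : ∀ i : Fin n, (h (x i)).flatMap enc.code = bif x i then c true else c false := by
      intro i
      cases x i <;> rfl
    simp only [this]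

section Reduction

variable {A : Type u} {κ : A → LetterKind}

/-! ### Heights -/

theorem height_append (u v : List A) : height κ (u ++ v) = height κ u + height κ v := by
  simp only [height, List.countP_append]
  push_cast
  ring

theorem height_cons (a : A) (v : List A) : height κ (a :: v) = height κ [a] + height κ v :=
  height_append [a] v

theorem height_flatten {k : ℤ} : ∀ l : List (List A), (∀ w ∈ l, height κ w = k) →
    height κ l.flatten = l.length * k
  | [], _ => by simp [height]
  | w :: l, h => by
    rw [List.flatten_cons, height_append, h w (List.mem_cons_self),
      height_flatten l fun w' hw' => h w' (List.mem_cons_of_mem _ hw')]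
    push_cast [List.length_cons]
    ring

theorem WellMatched.height_eq_zero {w : List A} (h : WellMatched κ w) : height κ w = 0 := by
  induction h with
  | nil => rfl
  | internal c hc => simp [height, hc]
  | wrap a b w ha hb _ ih =>
    rw [height_cons, height_append, ih]
    simp [height, ha, hb]
  | append s t _ _ ihs iht => rw [height_append, ihs, iht, add_zero]

/-- The stack height follows Δ unless the run empties the stack, which is possible because a return
may pop the bottom symbol. -/
theorem DVPA.length_run {Q G : Type} (M : DVPA κ Q G) : ∀ (w : List A) (q : Q) (β : List G),
    (M.run q w β).2 = [] ∨ ((M.run q w β).2.length : ℤ) = β.length + height κ w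
  | [], q, β => .inr (by simp [DVPA.run, height])
  | a :: w, q, [] => .inl rfl
  | a :: w, q, α :: β => by
    refine (M.length_run w _ _).imp id fun h => ?_
    rw [DVPA.run, h, height_cons, List.length_append]
    rcases ha : κ a with _ | _ | _
    · obtain ⟨γ, -, h⟩ := M.δ_call q a α ha
      simp [h, height, ha]
      ring
    · simp [M.δ_int q a α ha, height, ha, add_comm]
    · simp [M.δ_ret q a α ha, height, ha]

/-- An accepting run starts and ends with one stack symbol. This is all that the reduction needs
from the automaton. -/
theorem IsVPL.height_eq_zero {L : Set (List A)} (hL : IsVPL κ L) {w : List A} (hw : w ∈ L) :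
    height κ w = 0 := by
  obtain ⟨Q, G, -, -, M, rfl⟩ := hL
  have h2 : (M.run M.start w [M.bot]).2 = [M.bot] := hw.2
  rcases M.length_run w M.start [M.bot] with h | h
  · rw [h] at h2
    cases h2
  · rw [h2] at h
    simpa using h

/-! ### Contexts over a reachable idempotent -/

theorem mem_of_syntacticHom_mem {L : Set (List A)} {w : words κ}
    (h : (syntacticHom κ L).φ w ∈ (syntacticHom κ L).φ '' wordsIn κ L) : wordList w ∈ L := by
  obtain ⟨w', hw', h⟩ := h
  have hrel : (syntacticCongruence κ L).rel w' w :=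
    (Con.eq (syntacticCongruence κ L).toCon).1 h
  exact (hrel 1 (freeExt κ).O.one_mem).1 hw'

/-- The witnesses of reachability lift to a context (x, y) and a word z. They serve all contexts
over `e` at once, since membership in L depends only on syntactic classes. -/
theorem exists_forall_mem_of_opReachable {L : Set (List A)} {e : (syntacticExt κ L).O}
    (he : (syntacticExt κ L).OpReachable ((syntacticHom κ L).φ '' wordsIn κ L) e) :
    ∃ x y z : List A, ∀ ρ ∈ contextsOver (syntacticHom κ L) e,
      x ++ ρ.1 ++ z ++ ρ.2 ++ y ∈ L := by
  obtain ⟨r, f, ⟨f₀, ⟨τ, hτ, rfl⟩, hff⟩, hf⟩ := he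
  obtain ⟨z, rfl⟩ := Con.mk'_surjective r
  refine ⟨τ.1, τ.2, wordList z, ?_⟩
  rintro ρ ⟨hρ, rfl⟩
  have h : (syntacticHom κ L).φ (ext τ hτ (ext ρ hρ z)) ∈ (syntacticHom κ L).φ '' wordsIn κ L := by
    have h : f ((syntacticHom κ L).φ (ext ρ hρ z)) = (syntacticHom κ L).φ (ext τ hτ (ext ρ hρ z)) :=
      hff (ext ρ hρ z)
    exact h ▸ hf
  have := mem_of_syntacticHom_mem h
  simpa [wordList, ext] using this

theorem contextsOver_comp {X : ExtAlgebra.{u}} {h : ExtAlgebra.Hom (freeExt κ) X} {e : X.O}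
    (he : IsIdempotentElem e) {σ τ : List A × List A} (hσ : σ ∈ contextsOver h e)
    (hτ : τ ∈ contextsOver h e) : (σ.1 ++ τ.1, τ.2 ++ σ.2) ∈ contextsOver h e := by
  obtain ⟨hσ, hσe⟩ := hσ
  obtain ⟨hτ, hτe⟩ := hτ
  refine ⟨contexts_comp hσ hτ, ?_⟩
  have hmul : extOp _ (contexts_comp hσ hτ) = extOp σ hσ * extOp τ hτ := by
    apply Subtype.ext
    funext w
    apply Subtype.ext
    apply FreeMonoid.toList.injective
    change FreeMonoid.toList (FreeMonoid.ofList _) = _ ++ FreeMonoid.toList (FreeMonoid.ofList _) ++ _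
    simp
  rw [hmul, map_mul, hσe, hτe, he.eq]

/-! ### The reduction of `EQUALITY` -/

section Closed

variable {S : Set (List A × List A)}

theorem replicate_left_mem (hS : ∀ σ ∈ S, ∀ τ ∈ S, (σ.1 ++ τ.1, τ.2 ++ σ.2) ∈ S) {u : List A} :
    ∀ l : List (List A), l ≠ [] → (∀ v ∈ l, (u, v) ∈ S) →
      ((List.replicate l.length u).flatten, l.flatten) ∈ S
  | [], h, _ => (h rfl).elim
  | [v], _, h => by simpa using h v
  | v :: v' :: l, _, h => by
    have := hS _ (replicate_left_mem hS (v' :: l) (List.cons_ne_nil _ _) fun c hc =>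
      h c (List.mem_cons_of_mem _ hc)) _ (h v List.mem_cons_self)
    rw [List.length_cons, List.replicate_succ', List.flatten_concat, List.flatten_cons]
    exact this

theorem replicate_right_mem (hS : ∀ σ ∈ S, ∀ τ ∈ S, (σ.1 ++ τ.1, τ.2 ++ σ.2) ∈ S) {v : List A} :
    ∀ l : List (List A), l ≠ [] → (∀ u ∈ l, (u, v) ∈ S) →
      (l.flatten, (List.replicate l.length v).flatten) ∈ S
  | [], h, _ => (h rfl).elim
  | [u], _, h => by simpa using h u
  | u :: u' :: l, _, h => by
    have := hS _ (h u List.mem_cons_self) _ (replicate_right_mem hS (u' :: l)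
      (List.cons_ne_nil _ _) fun c hc => h c (List.mem_cons_of_mem _ hc))
    rw [List.length_cons, List.replicate_succ', List.flatten_concat, List.flatten_cons]
    exact this

variable {L : Set (List A)} {x y z : List A}

/-- With the right exponent the word lies in L and has height 0. Any other exponent changes the
height by a nonzero multiple of Δ(u). -/
theorem replicate_left_mem_iff (hS : ∀ σ ∈ S, ∀ τ ∈ S, (σ.1 ++ τ.1, τ.2 ++ σ.2) ∈ S)
    (hL : ∀ w ∈ L, height κ w = 0)
    (hSL : ∀ σ ∈ S, x ++ σ.1 ++ z ++ σ.2 ++ y ∈ L) {u : List A} (hu : 0 < height κ u)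
    {l : List (List A)} (hl : l ≠ []) (hlS : ∀ v ∈ l, (u, v) ∈ S) (N : ℕ) :
    x ++ (List.replicate N u).flatten ++ z ++ l.flatten ++ y ∈ L ↔ l.length = N := by
  have hmem := hSL _ (replicate_left_mem hS l hl hlS)
  refine ⟨fun h => ?_, fun h => h ▸ hmem⟩
  have h₁ := hL _ hmem
  have h₂ := hL _ h
  have hr : ∀ m, height κ (List.replicate m u).flatten = m * height κ u := fun m => by
    rw [height_flatten _ fun w hw => congrArg _ (List.eq_of_mem_replicate hw), List.length_replicate]
  simp only [height_append, hr] at h₁ h₂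
  have : (l.length : ℤ) * height κ u = N * height κ u := by linarith
  exact_mod_cast mul_right_cancel₀ hu.ne' this

theorem replicate_right_mem_iff (hS : ∀ σ ∈ S, ∀ τ ∈ S, (σ.1 ++ τ.1, τ.2 ++ σ.2) ∈ S)
    (hL : ∀ w ∈ L, height κ w = 0)
    (hSL : ∀ σ ∈ S, x ++ σ.1 ++ z ++ σ.2 ++ y ∈ L) {v : List A} (hv : height κ v < 0)
    {l : List (List A)} (hl : l ≠ []) (hlS : ∀ u ∈ l, (u, v) ∈ S) (N : ℕ) :
    x ++ l.flatten ++ z ++ (List.replicate N v).flatten ++ y ∈ L ↔ l.length = N := by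
  have hmem := hSL _ (replicate_right_mem hS l hl hlS)
  refine ⟨fun h => ?_, fun h => h ▸ hmem⟩
  have h₁ := hL _ hmem
  have h₂ := hL _ h
  have hr : ∀ m, height κ (List.replicate m v).flatten = m * height κ v := fun m => by
    rw [height_flatten _ fun w hw => congrArg _ (List.eq_of_mem_replicate hw), List.length_replicate]
  simp only [height_append, hr] at h₁ h₂
  have : (l.length : ℤ) * height κ v = N * height κ v := by linarith
  exact_mod_cast mul_right_cancel₀ hv.ne this

/-- Powers of two words that have the same length. -/
def balancedBlock (c d : List A) (b : Bool) : List (List A) :=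
  bif b then List.replicate (2 * c.length) d else List.replicate (2 * d.length) c

theorem mem_flatMap_balancedBlock {c d w : List A} {t : List Bool}
    (h : w ∈ t.flatMap (balancedBlock c d)) : w = c ∨ w = d := by
  obtain ⟨_ | _, -, h⟩ := List.mem_flatMap.1 h
  · exact .inl (List.eq_of_mem_replicate h)
  · exact .inr (List.eq_of_mem_replicate h)

theorem length_flatMap_balancedBlock_eq_iff {c d : List A} (h : c.length ≠ d.length)
    (t : List Bool) :
    (t.flatMap (balancedBlock c d)).length = (c.length + d.length) * t.length ↔
      t ∈ EQUALITY := by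
  have hlen : (t.flatMap (balancedBlock c d)).length =
      2 * c.length * t.count true + 2 * d.length * t.count false := by
    induction t with
    | nil => rfl
    | cons b t ih =>
      rw [List.flatMap_cons, List.length_append, ih]
      cases b <;> simp [balancedBlock] <;> ring
  rw [hlen, ← List.count_false_add_count_true t, EQUALITY, Set.mem_ofPred_eq]
  constructor
  · intro h'
    -- The difference of the two sides factors; the first factor is nonzero by `h`.
    have h₀ : ((c.length : ℤ) - d.length) * (t.count false - t.count true) = 0 := by
      have : (2 * c.length * t.count true + 2 * d.length * t.count false : ℤ) =
        (c.length + d.length) * (t.count false + t.count true) := by exact_mod_cast h'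
      linarith
    rcases mul_eq_zero.1 h₀ with h₀ | h₀ <;> omega
  · intro h'
    rw [h']
    ring

theorem length_flatten_balancedBlock (c d : List A) :
    (balancedBlock c d false).flatten.length = (balancedBlock c d true).flatten.length := by
  simp [balancedBlock]
  ring

theorem polyBounded_length_power (c d : List A) (v w w' : List A) :
    PolyBounded fun n =>
      (w ++ (List.replicate ((c.length + d.length) * n + 1) v).flatten ++ w').length := by
  refine (((PolyBounded.const w.length).add
    ((((PolyBounded.const (c.length + d.length)).mul .id).add (.const 1)).mul
      (.const v.length))).add (.const w'.length)).mono fun n => ?_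
  simp [add_assoc]

theorem cdReducible_EQUALITY (enc : BlockEncoding A)
    (hS : ∀ σ ∈ S, ∀ τ ∈ S, (σ.1 ++ τ.1, τ.2 ++ σ.2) ∈ S)
    (hS₀ : ∀ σ ∈ S, height κ σ.1 + height κ σ.2 = 0) (hL : ∀ w ∈ L, height κ w = 0)
    (hSL : ∀ σ ∈ S, x ++ σ.1 ++ z ++ σ.2 ++ y ∈ L) (hsync : ¬ WeaklyLengthSynchronousSet κ S) :
    CDReducible EQUALITY (enc.language L) := by
  simp only [WeaklyLengthSynchronousSet, not_forall] at hsync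
  obtain ⟨⟨u, v⟩, hσ, ⟨u', v'⟩, hτ, hu, hu', hne⟩ := hsync
  rw [not_and_or] at hne
  simp only [Classical.not_imp] at hne hu hu'
  rcases hne with ⟨rfl, hne⟩ | ⟨rfl, hne⟩
  · refine cdReducible_of_blocks enc
      (fun n => x ++ (List.replicate ((v.length + v'.length) * n + 1) u).flatten ++ z)
      (fun _ => v ++ y) (fun b => (balancedBlock v v' b).flatten)
      (polyBounded_length_power _ _ _ _ _) (.const _) (length_flatten_balancedBlock v v')
      fun t => ?_
    rw [← length_flatMap_balancedBlock_eq_iff hne, ← Nat.add_right_cancel_iff (n := 1)]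
    -- The additional factor `v`, matched by the `+ 1` in the exponent, keeps the list nonempty for
    -- empty `t`: the empty context need not lie in `S`.
    have := replicate_left_mem_iff hS hL hSL hu
      (l := t.flatMap (balancedBlock v v') ++ [v]) (by simp) (fun c hc => by
        rcases List.mem_append.1 hc with hc | hc
        · rcases mem_flatMap_balancedBlock hc with rfl | rfl <;> assumption
        · rw [List.mem_singleton.1 hc]
          exact hσ) ((v.length + v'.length) * t.length + 1)
    rw [List.length_append, List.length_singleton] at this
    rw [← this]
    simp [List.flatMap_def, List.flatten_flatten, Function.comp_def]
  -- Now the right word is common, and its negative height does the counting.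
  · have hv : height κ v < 0 := by linarith [hS₀ _ hσ]
    refine cdReducible_of_blocks enc (fun _ => x ++ u)
      (fun n => z ++ (List.replicate ((u.length + u'.length) * n + 1) v).flatten ++ y)
      (fun b => (balancedBlock u u' b).flatten)
      (.const _) (polyBounded_length_power _ _ _ _ _) (length_flatten_balancedBlock u u')
      fun t => ?_
    rw [← length_flatMap_balancedBlock_eq_iff hne, ← Nat.add_right_cancel_iff (n := 1)]
    have := replicate_right_mem_iff hS hL hSL hv
      (l := u :: t.flatMap (balancedBlock u u')) (by simp) (fun c hc => by
        rcases List.mem_cons.1 hc with rfl | hc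
        · exact hσ
        · rcases mem_flatMap_balancedBlock hc with rfl | rfl <;> assumption)
      ((u.length + u'.length) * t.length + 1)
    rw [List.length_cons] at this
    rw [← this]
    simp [List.flatMap_def, List.flatten_flatten, Function.comp_def]

end Closed

end Reduction

end VPL

/-! ### The proposition. -/

theorem mainTheorem7 {A : Type*} [Finite A] (κ : A → VPL.LetterKind) (enc : VPL.BlockEncoding A)
    (L : Set (List A)) (hL : VPL.IsVPL κ L) (hsync : ¬ VPL.WeaklyLengthSynchronous κ L) :
    VPL.CDReducible VPL.EQUALITY (enc.language L) ∧
    (∀ K : Set (List Bool), VPL.CDReducible K VPL.EQUALITY →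
      VPL.CDReducible K (enc.language L)) ∧
    (∀ K ∈ VPL.TC0, VPL.CDTuringReducible K (enc.language L)) := by
  have h : VPL.CDReducible VPL.EQUALITY (enc.language L) := by
    simp only [VPL.WeaklyLengthSynchronous, VPL.ExtAlgebra.Hom.WeaklyLengthSynchronous,
      not_forall] at hsync
    obtain ⟨e, he, hreach, hsync⟩ := hsync
    obtain ⟨x, y, z, hmem⟩ := VPL.exists_forall_mem_of_opReachable hreach
    refine VPL.cdReducible_EQUALITY enc (fun σ hσ τ hτ => VPL.contextsOver_comp he hσ hτ)
      (fun σ hσ => ?_) (fun w hw => hL.height_eq_zero hw) hmem hsync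
    obtain ⟨hσ, -⟩ := hσ
    rw [← VPL.height_append]
    exact VPL.WellMatched.height_eq_zero hσ
  refine ⟨h, fun K hK => hK.trans h, fun K hK => VPL.cdTuringReducible_of_mem_TC0 hK ?_⟩
  obtain ⟨C, hC, hCK, hC'⟩ := VPL.cdReducible_MAJORITY_EQUALITY.trans h
  exact ⟨C, hC, hCK, fun n => (hC' n).1⟩
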